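/- Let $(M,\omega)$ be a compact simply connected symplectic manifold of real dimension $2n$, let $(L,h)\to M$ be a hermitian line bundle, and let $a\in\mathcal O(\omega)$, i.e. $a$ is a hermitian connection on $(L,h)$ with curvature $F_a=2\pi i\,\omega$. Let $N$ be a compact connected smooth $n$-manifold, and let $\mathcal B_S$ be the space of Bohr–Sommerfeld lagrangian submanifolds of type $N$: the lagrangian submanifolds $S\subset M$ that are images of smooth embeddings $N\to M$ and for which $(L,a)|_S$ has a nowhere vanishing covariantly constant section $\sigma_S$. Give $\mathcal B_S$ the $C^1$ topology (the quotient, by reparametrization, of the $C^1$ topology on embeddings). Let $\Gamma(M,L)$ be the space of smooth sections of $L$, and let $\mathcal U_{SBS}(a)\subset\mathbb P\Gamma(M,L)\times\mathcal B_S$ be the set of pairs $([\alpha],S)$ such that $\alpha|_S=e^{ic}f\,\sigma_S$ for some covariantly constant $\sigma_S\neq 0$, some real constant $c$ and some smooth $f:S\to\mathbb R$ with $f>0$. For $F\in C^\infty(M,\mathbb R)$ put $P(F)[\alpha]=[e^{iF}\alpha]$, and for $D\subset M$ let $\mathbb P(D)\subset\mathbb P\Gamma(M,L)$ be the set of classes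 of sections whose zero set is exactly $D$. Let $([\alpha],S)\in\mathcal U_{SBS}(a)$. Then $S$ has a neighbourhood in $\mathcal B_S$ such that for every $S_\delta$ in it there is a function $F_\delta\in C^\infty(M,\mathbb R)$ with $(P(F_\delta)[\alpha],S_\delta)\in\mathcal U_{SBS}(a)$; moreover $P(F_\delta)[\alpha]$ lies in the same $\mathbb P(D)$ as $[\alpha]$. -/

import Mathlib

open Manifold Bundle Set Filter Topology
open scoped ContDiff LinearAlgebra.Projectivization

noncomputable section

namespace SBS

section Symplectic

variable (n : ℕ) (M : Type*) [TopologicalSpace M]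
  [ChartedSpace (EuclideanSpace ℝ (Fin (2 * n))) M] [IsManifold (𝓡 (2 * n)) ∞ M]

/-- A symplectic form on a smooth manifold of dimension `2 n`: a smooth, alternating,
nondegenerate and closed 2-form. -/
structure SymplecticForm where
  /-- the bilinear form on each tangent space -/
  form : Π x : M, TangentSpace (𝓡 (2 * n)) x →L[ℝ] TangentSpace (𝓡 (2 * n)) x →L[ℝ] ℝ
  smooth : ContMDiff (𝓡 (2 * n))
    ((𝓡 (2 * n)).prod 𝓘(ℝ, EuclideanSpace ℝ (Fin (2 * n)) →L[ℝ]
      EuclideanSpace ℝ (Fin (2 * n)) →L[ℝ] ℝ)) ∞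
    (fun x ↦ TotalSpace.mk' (EuclideanSpace ℝ (Fin (2 * n)) →L[ℝ]
      EuclideanSpace ℝ (Fin (2 * n)) →L[ℝ] ℝ) x (form x))
  alternating : ∀ x v, form x v v = 0
  nondegenerate : ∀ x v, (∀ w, form x v w = 0) → v = 0
  /-- `dω (X, Y, Z) = 0` for all smooth vector fields, by the invariant formula for `dω` -/
  closed : ∀ X Y Z : Cₛ^∞⟮𝓡 (2 * n); EuclideanSpace ℝ (Fin (2 * n)),
      (fun x : M ↦ TangentSpace (𝓡 (2 * n)) x)⟯, ∀ x,
    mvfderiv (𝓡 (2 * n)) (fun y ↦ form y (Y y) (Z y)) x (X x)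
      - mvfderiv (𝓡 (2 * n)) (fun y ↦ form y (X y) (Z y)) x (Y x)
      + mvfderiv (𝓡 (2 * n)) (fun y ↦ form y (X y) (Y y)) x (Z x)
      - form x (VectorField.mlieBracket (𝓡 (2 * n)) X Y x) (Z x)
      + form x (VectorField.mlieBracket (𝓡 (2 * n)) X Z x) (Y x)
      - form x (VectorField.mlieBracket (𝓡 (2 * n)) Y Z x) (X x) = 0

end Symplectic

/-! A smooth hermitian line bundle over `M` is a family `L` of complex inner product spaces with a
fiber bundle structure of model fiber `ℂ` whose trivializations are fiberwise `ℂ`-linear, such that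
the coordinate changes are smooth (over `ℝ`) and the hermitian structure is smooth
(`IsSmoothHermitian` below). -/

variable {n : ℕ} {M : Type*} [TopologicalSpace M]
  [ChartedSpace (EuclideanSpace ℝ (Fin (2 * n))) M] [IsManifold (𝓡 (2 * n)) ∞ M]
  {L : M → Type*} [TopologicalSpace (TotalSpace ℂ L)]
  [∀ x, NormedAddCommGroup (L x)] [∀ x, InnerProductSpace ℂ (L x)]
  [FiberBundle ℂ L] [VectorBundle ℂ ℂ L] [VectorBundle ℝ ℂ L]
  [ContMDiffVectorBundle ∞ ℂ L (𝓡 (2 * n))]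

/-- Product of a smooth complex valued function and a smooth section. -/
theorem contMDiff_smul {g : M → ℂ} {s : Π x, L x} (hg : ContMDiff (𝓡 (2 * n)) 𝓘(ℝ, ℂ) ∞ g)
    (hs : ContMDiff (𝓡 (2 * n)) ((𝓡 (2 * n)).prod 𝓘(ℝ, ℂ)) ∞ (fun x ↦ TotalSpace.mk' ℂ x (s x))) :
    ContMDiff (𝓡 (2 * n)) ((𝓡 (2 * n)).prod 𝓘(ℝ, ℂ)) ∞
      (fun x ↦ TotalSpace.mk' ℂ x (g x • s x)) := by
  intro x₀
  have h := hs x₀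
  rw [contMDiffAt_section] at h ⊢
  have hm : ContDiff ℝ ∞ (fun z : ℂ × ℂ ↦ z.1 * z.2) := contDiff_fst.mul contDiff_snd
  refine (hm.comp_contMDiffAt ((hg x₀).prodMk_space h)).congr_of_eventuallyEq ?_
  set e := trivializationAt ℂ L x₀
  filter_upwards [e.open_baseSet.mem_nhds (mem_baseSet_trivializationAt ℂ L x₀)] with x hx
  exact (e.linear ℂ hx).2 (g x) (s x)

variable (n L) in
/-- The complex vector space `Γ(M, L)` of smooth sections. -/
def Sections : Submodule ℂ (Π x, L x) where
  carrier := {s | ContMDiff (𝓡 (2 * n)) ((𝓡 (2 * n)).prod 𝓘(ℝ, ℂ)) ∞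
    (fun x ↦ TotalSpace.mk' ℂ x (s x))}
  add_mem' hs ht := ContMDiff.add_section (𝕜 := ℝ) hs ht
  zero_mem' := contMDiff_zeroSection ℝ L
  smul_mem' _ _ hs := contMDiff_smul contMDiff_const hs

/-- The linear map `α ↦ e^{iF} α` on smooth sections. -/
def phaseMul (F : C^∞⟮𝓡 (2 * n), M; ℝ⟯) : Sections n L →ₗ[ℂ] Sections n L where
  toFun s := ⟨fun x ↦ Complex.exp (Complex.I * (F x : ℂ)) • (s : Π x, L x) x, by
    refine contMDiff_smul ?_ s.2
    have h : ContDiff ℝ ∞ (fun t : ℝ ↦ Complex.exp (Complex.I * (t : ℂ))) :=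
      (contDiff_const.mul Complex.ofRealCLM.contDiff).cexp
    exact h.comp_contMDiff F.contMDiff⟩
  map_add' s t := Subtype.ext (funext fun _ ↦ smul_add _ _ _)
  map_smul' c s := Subtype.ext (funext fun _ ↦ smul_comm _ _ _)

theorem phaseMul_injective (F : C^∞⟮𝓡 (2 * n), M; ℝ⟯) :
    Function.Injective (phaseMul (L := L) F) := by
  intro s t h
  refine Subtype.ext (funext fun x ↦ ?_)
  exact smul_right_injective (L x) (Complex.exp_ne_zero (Complex.I * (F x : ℂ)))
    (congrFun (congrArg Subtype.val h) x)

/-- The projective transformation `P(F) : [α] ↦ [e^{iF} α]` of `ℙ Γ(M, L)`. -/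
def phase (F : C^∞⟮𝓡 (2 * n), M; ℝ⟯) : ℙ ℂ (Sections n L) → ℙ ℂ (Sections n L) :=
  Projectivization.map (phaseMul F) (phaseMul_injective F)

/-- `ℙ(D)`: the classes of sections whose zero set is exactly `D`. -/
def vanishingOn (D : Set M) : Set (ℙ ℂ (Sections n L)) :=
  {p | ∃ (α : Sections n L) (hα : α ≠ 0), p = Projectivization.mk ℂ α hα ∧
    {x | (α : Π x, L x) x = 0} = D}

variable (n L) in
/-- The hermitian structure on `L` is smooth: so is the product of any two smooth sections. -/
def IsSmoothHermitian : Prop :=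
  ∀ s ∈ Sections n L, ∀ t ∈ Sections n L,
    ContMDiff (𝓡 (2 * n)) 𝓘(ℝ, ℂ) ∞ (fun x ↦ inner ℂ (s x) (t x))

/-- The connections `𝒪(ω)`: smooth `ℂ`-linear connections on `L`, compatible with the hermitian
structure, whose curvature is `2πi ω`. -/
structure IsPrequantum (Ω : SymplecticForm n M) (a : CovariantDerivative (𝓡 (2 * n)) ℂ L) :
    Prop where
  smooth : CovariantDerivative.ContMDiffCovariantDerivative a ∞
  complex_linear : ∀ s ∈ Sections n L, ∀ x v,
    a (fun y ↦ Complex.I • s y) x v = Complex.I • a s x v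
  hermitian : ∀ s ∈ Sections n L, ∀ t ∈ Sections n L, ∀ x v,
    mvfderiv (𝓡 (2 * n)) (fun y ↦ inner ℂ (s y) (t y)) x v
      = inner ℂ (a s x v) (t x) + inner ℂ (s x) (a t x v)
  curvature : ∀ X Y : Cₛ^∞⟮𝓡 (2 * n); EuclideanSpace ℝ (Fin (2 * n)),
      (fun x : M ↦ TangentSpace (𝓡 (2 * n)) x)⟯, ∀ s ∈ Sections n L, ∀ x,
    a (fun y ↦ a s y (Y y)) x (X x) - a (fun y ↦ a s y (X y)) x (Y x)
      - a s x (VectorField.mlieBracket (𝓡 (2 * n)) X Y x)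
      = (2 * (Real.pi : ℂ) * Complex.I * (Ω.form x (X x) (Y x) : ℂ)) • s x

section Lagrangian

variable {N : Type*} [TopologicalSpace N] [ChartedSpace (EuclideanSpace ℝ (Fin n)) N]
  [IsManifold (𝓡 n) ∞ N]

/-- `σ` restricts to a smooth covariantly constant section of `L` along the map `i : N → M`:
near each `y` the section `σ ∘ i` of the pulled back bundle is the restriction of a smooth section
`s` of `L`, and `∇ s` vanishes at `i y` in the directions tangent to `i`. Only the values of `σ` on
the image of `i` matter. -/
def IsCovariantlyConstantAlong (a : CovariantDerivative (𝓡 (2 * n)) ℂ L) (i : N → M)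
    (σ : Π x, L x) : Prop :=
  ∀ y : N, ∃ s ∈ Sections n L, (∀ᶠ y' in 𝓝 y, s (i y') = σ (i y')) ∧
    ∀ v : TangentSpace (𝓡 n) y, a s (i y) (mfderiv (𝓡 n) (𝓡 (2 * n)) i y v) = 0

/-- Smooth embeddings of `N` whose image is a Bohr-Sommerfeld lagrangian submanifold: `ω` restricts
to zero and `(L, a)` restricted to the image has a nonvanishing covariantly constant section. -/
structure IsBohrSommerfeld (Ω : SymplecticForm n M) (a : CovariantDerivative (𝓡 (2 * n)) ℂ L)
    (i : N → M) : Prop where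
  embedding : IsSmoothEmbedding (𝓡 n) (𝓡 (2 * n)) ∞ i
  lagrangian : ∀ (y : N) (v w : TangentSpace (𝓡 n) y),
    Ω.form (i y) (mfderiv (𝓡 n) (𝓡 (2 * n)) i y v) (mfderiv (𝓡 n) (𝓡 (2 * n)) i y w) = 0
  exists_section : ∃ σ : Π x, L x, IsCovariantlyConstantAlong a i σ ∧ ∀ y, σ (i y) ≠ 0

variable (N) in
/-- Bohr-Sommerfeld lagrangian embeddings of `N`. -/
structure BSEmbedding (Ω : SymplecticForm n M) (a : CovariantDerivative (𝓡 (2 * n)) ℂ L) where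
  /-- the underlying map -/
  toFun : N → M
  isBohrSommerfeld : IsBohrSommerfeld Ω a toFun

/-- The tangent map `T N → T M` of a Bohr-Sommerfeld embedding. -/
def BSEmbedding.tangent {Ω : SymplecticForm n M} {a : CovariantDerivative (𝓡 (2 * n)) ℂ L}
    (i : BSEmbedding N Ω a) : C(TangentBundle (𝓡 n) N, TangentBundle (𝓡 (2 * n)) M) :=
  ⟨tangentMap (𝓡 n) (𝓡 (2 * n)) i.toFun,
    i.isBohrSommerfeld.embedding.contMDiff.continuous_tangentMap (by simp)⟩

/-- The `C^1` topology on embeddings: the coarsest one for which the tangent map depends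
continuously on the embedding, for the compact-open topology on continuous maps `T N → T M`. -/
instance (Ω : SymplecticForm n M) (a : CovariantDerivative (𝓡 (2 * n)) ℂ L) :
    TopologicalSpace (BSEmbedding N Ω a) :=
  TopologicalSpace.induced BSEmbedding.tangent inferInstance

variable (N) in
/-- The moduli space `ℬ_S` of Bohr-Sommerfeld lagrangian submanifolds of `M` of type `N`. -/
structure BSLagrangian (Ω : SymplecticForm n M) (a : CovariantDerivative (𝓡 (2 * n)) ℂ L) where
  /-- the underlying subset of `M` -/
  carrier : Set M
  exists_param : ∃ i : BSEmbedding N Ω a, range i.toFun = carrier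

/-- The image of a Bohr-Sommerfeld embedding. -/
def BSEmbedding.image {Ω : SymplecticForm n M} {a : CovariantDerivative (𝓡 (2 * n)) ℂ L}
    (i : BSEmbedding N Ω a) : BSLagrangian N Ω a :=
  ⟨range i.toFun, i, rfl⟩

/-- The `C^1` topology on the moduli space: the quotient of the space of embeddings by
reparametrization. -/
instance (Ω : SymplecticForm n M) (a : CovariantDerivative (𝓡 (2 * n)) ℂ L) :
    TopologicalSpace (BSLagrangian N Ω a) :=
  TopologicalSpace.coinduced BSEmbedding.image inferInstance

variable (N) in
/-- The universal object `𝒰_SBS(a)`: the pairs `([α], S)` such that `α|_S = e^{ic} f σ_S` with `σ_S`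
a (nonzero) covariantly constant section of `(L, a)|_S`, `c` a real constant and `f` a strictly
positive smooth function on `S`. -/
def universalSBS (Ω : SymplecticForm n M) (a : CovariantDerivative (𝓡 (2 * n)) ℂ L) :
    Set (ℙ ℂ (Sections n L) × BSLagrangian N Ω a) :=
  {q | ∃ (α : Sections n L) (hα : α ≠ 0) (i : BSEmbedding N Ω a) (σ : Π x, L x) (c : ℝ)
      (f : N → ℝ),
    q = (Projectivization.mk ℂ α hα, i.image) ∧
    IsCovariantlyConstantAlong a i.toFun σ ∧ (∀ y, σ (i.toFun y) ≠ 0) ∧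
    ContMDiff (𝓡 n) 𝓘(ℝ, ℝ) ∞ f ∧ (∀ y, 0 < f y) ∧
    ∀ y, (α : Π x, L x) (i.toFun y) =
      (Complex.exp (Complex.I * (c : ℂ)) * (f y : ℂ)) • σ (i.toFun y)}

end Lagrangian

end SBS

end

/-! Along a Bohr–Sommerfeld `i : N → M` with covariantly constant section `τ`, write `α = g τ`.
Since `∇τ = 0` along `i`, `dg = λ(Ti ·) g`, where `λ = ∇α/α` (`logCov`) is a function of tangent
vectors of `M` that involves neither `i` nor `τ`. Hence the phase `u = g/|g|` satisfies `|du| = |Im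
λ(Ti ·)|` (`norm_mvfderiv_phase_coeffAlong`).

On `TS` the phase is constant, so `Im λ = 0` there. For `i` close to `S` in `C^1`, `Im λ(Ti ·)` is
therefore small on any prescribed compact set of tangent vectors. As `N` is compact and connected,
such a bound controls the oscillation of `u` (`exists_isCompact_forall_norm_sub_le_mul`), so `u`
stays within distance 1 of a constant `ζ` and `u = e^{iθ} ζ` with a single-valued smooth `θ : N →
ℝ`. Extending `-θ` to `F` on `M` gives `e^{iF} α = ζ |g| τ` along `i`. The zero set is unchanged
because `e^{iF}` never vanishes. -/

noncomputable section

namespace SBS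

/-! ### Oscillation bounds from derivative bounds on compact sets of tangent vectors. -/

section Oscillation

variable {m : ℕ} {N : Type*} [TopologicalSpace N] [ChartedSpace (EuclideanSpace ℝ (Fin m)) N]
  [IsManifold (𝓡 m) ∞ N]

/-- Near each point, the oscillation of a function is controlled by its derivative on a compact
set of tangent vectors. -/
theorem exists_isCompact_forall_norm_sub_le (y : N) :
    ∃ U ∈ 𝓝 y, ∃ K : Set (TangentBundle (𝓡 m) N), IsCompact K ∧
      ∀ (u : N → ℂ) (ε : ℝ), MDifferentiable (𝓡 m) 𝓘(ℝ, ℂ) u → 0 ≤ ε →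
        (∀ w ∈ K, ‖mvfderiv (𝓡 m) u w.proj w.2‖ ≤ ε) → ∀ y₁ ∈ U, ∀ y₂ ∈ U, ‖u y₁ - u y₂‖ ≤ ε := by
  set c := extChartAt (𝓡 m) y
  have hopen : IsOpen c.target := isOpen_extChartAt_target y
  obtain ⟨r₀, hr₀, hball₀⟩ := Metric.isOpen_iff.1 hopen (c y) (mem_extChartAt_target y)
  -- Radius at most 1/2 makes the diameter at most 1, so the mean value inequality yields exactly
  -- `ε`; radius below `r₀` keeps the closed ball inside the chart target.
  obtain ⟨r, hr, hr1, hrr⟩ : ∃ r : ℝ, 0 < r ∧ r ≤ 1 / 2 ∧ r < r₀ :=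
    ⟨min (1 / 2) (r₀ / 2), by positivity, min_le_left _ _,
      (min_le_right _ _).trans_lt (by linarith)⟩
  have hball : Metric.closedBall (c y) r ⊆ c.target :=
    (Metric.closedBall_subset_ball hrr).trans hball₀
  have hsymm : ContMDiffOn 𝓘(ℝ, EuclideanSpace ℝ (Fin m)) (𝓡 m) ∞ c.symm c.target :=
    contMDiffOn_extChartAt_symm y
  -- `f (z, v)` is the vector `v` at `z` transported by the inverse chart; `K` is the image of
  -- closed ball times closed unit ball.
  let f : EuclideanSpace ℝ (Fin m) × EuclideanSpace ℝ (Fin m) → TangentBundle (𝓡 m) N :=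
    fun p ↦ tangentMapWithin 𝓘(ℝ, EuclideanSpace ℝ (Fin m)) (𝓡 m) c.symm c.target
      ((tangentBundleModelSpaceHomeomorph 𝓘(ℝ, EuclideanSpace ℝ (Fin m))).symm p)
  have hf : ContinuousOn f (Metric.closedBall (c y) r ×ˢ Metric.closedBall 0 1) := by
    refine (hsymm.continuousOn_tangentMapWithin (by simp) hopen.uniqueMDiffOn).comp
      (Homeomorph.continuous _).continuousOn ?_
    rintro ⟨z, v⟩ ⟨hz, -⟩
    exact hball hz
  refine ⟨c.source ∩ c ⁻¹' Metric.ball (c y) r, ?_, f '' _,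
    ((isCompact_closedBall _ _).prod (isCompact_closedBall _ _)).image_of_continuousOn hf, ?_⟩
  · exact inter_mem (extChartAt_source_mem_nhds y)
      ((continuousAt_extChartAt y).preimage_mem_nhds (Metric.ball_mem_nhds _ hr))
  intro u ε hu hε hK y₁ hy₁ y₂ hy₂
  have hd : ∀ z ∈ Metric.closedBall (c y) r, HasFDerivAt (u ∘ c.symm)
      (mvfderiv (𝓡 m) u (c.symm z) ∘L
        mfderivWithin 𝓘(ℝ, EuclideanSpace ℝ (Fin m)) (𝓡 m) c.symm c.target z) z := by
    intro z hz
    have h1 := ((hsymm z (hball hz)).mdifferentiableWithinAt (by simp)).hasMFDerivWithinAt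
    have h2 := h1.hasMFDerivAt (hopen.mem_nhds (hball hz))
    exact ((hu (c.symm z)).hasMFDerivAt.comp z h2).hasFDerivAt
  have key := (convex_closedBall (c y) r).norm_image_sub_le_of_norm_hasFDerivWithin_le
    (fun z hz ↦ (hd z hz).hasFDerivWithinAt) (C := ε) (fun z hz ↦ ?_)
    (Metric.ball_subset_closedBall hy₂.2) (Metric.ball_subset_closedBall hy₁.2)
  · simp only [Function.comp_apply, c.left_inv hy₁.1, c.left_inv hy₂.1] at key
    refine key.trans ?_
    have : ‖c y₁ - c y₂‖ ≤ 1 := by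
      have h1 := hy₁.2
      have h2 := hy₂.2
      simp only [mem_preimage, Metric.mem_ball] at h1 h2
      rw [← dist_eq_norm]
      linarith [dist_triangle_right (c y₁) (c y₂) (c y)]
    nlinarith
  · refine ContinuousLinearMap.opNorm_le_of_unit_norm hε fun v hv ↦ ?_
    exact hK (f (z, v)) ⟨(z, v), ⟨hz, by simp [hv]⟩, rfl⟩

/-- On a compact connected manifold, the oscillation of a function is controlled by its derivative
on a compact set of tangent vectors. -/
theorem exists_isCompact_forall_norm_sub_le_mul [CompactSpace N] [ConnectedSpace N] (y₀ : N) :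
    ∃ (K : Set (TangentBundle (𝓡 m) N)) (C : ℝ), IsCompact K ∧ 0 ≤ C ∧
      ∀ (u : N → ℂ) (ε : ℝ), MDifferentiable (𝓡 m) 𝓘(ℝ, ℂ) u → 0 ≤ ε →
        (∀ w ∈ K, ‖mvfderiv (𝓡 m) u w.proj w.2‖ ≤ ε) → ∀ y, ‖u y - u y₀‖ ≤ C * ε := by
  -- `K` and `C` may depend on the set `s` but not on the function `u`.
  let P : Set N → Prop := fun s ↦
    ∃ (K : Set (TangentBundle (𝓡 m) N)) (C : ℝ), IsCompact K ∧ 0 ≤ C ∧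
      ∀ (u : N → ℂ) (ε : ℝ), MDifferentiable (𝓡 m) 𝓘(ℝ, ℂ) u → 0 ≤ ε →
        (∀ w ∈ K, ‖mvfderiv (𝓡 m) u w.proj w.2‖ ≤ ε) → ∀ y ∈ s, ‖u y - u y₀‖ ≤ C * ε
  have hstep : ∀ y : N, ∃ U ∈ 𝓝 y, ∀ y' ∈ U, P {y'} → P U := by
    intro y
    obtain ⟨U, hU, K, hK, h⟩ := exists_isCompact_forall_norm_sub_le (m := m) y
    refine ⟨U, hU, fun y' hy' ⟨K', C, hK', hC, h'⟩ ↦ ⟨K ∪ K', C + 1, hK.union hK', by positivity,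
      fun u ε hu hε hw z hz ↦ ?_⟩⟩
    have h1 := h u ε hu hε (fun w hwK ↦ hw w (.inl hwK)) z hz y' hy'
    have h2 := h' u ε hu hε (fun w hwK ↦ hw w (.inr hwK)) y' rfl
    linarith [norm_sub_le_norm_sub_add_norm_sub (u z) (u y') (u y₀)]
  have hmono : ∀ s t, s ⊆ t → P t → P s := fun s t hst ⟨K, C, hK, hC, h⟩ ↦
    ⟨K, C, hK, hC, fun u ε hu hε hw y hy ↦ h u ε hu hε hw y (hst hy)⟩
  have h₀ : P {y₀} := ⟨∅, 0, isCompact_empty, le_rfl, fun u ε _ _ _ y hy ↦ by simp_all⟩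
  -- A bound at one point of a small `U` spreads to all of `U` by `hstep`, so `A` is clopen;
  -- compactness then leaves finitely many pairs `K`, `C` to combine.
  let A : Set N := {y | ∃ U ∈ 𝓝 y, P U}
  have hAo : IsOpen A := by
    rw [isOpen_iff_mem_nhds]
    rintro y ⟨U, hU, hP⟩
    filter_upwards [eventually_mem_nhds_iff.2 hU] with z hz using ⟨U, hz, hP⟩
  have hAc : IsClosed A := by
    refine isClosed_of_closure_subset fun y hy ↦ ?_
    obtain ⟨U, hU, h⟩ := hstep y
    obtain ⟨y', hy'U, V, hV, hPV⟩ := mem_closure_iff_nhds.1 hy U hU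
    exact ⟨U, hU, h y' hy'U (hmono _ _ (singleton_subset_iff.2 (mem_of_mem_nhds hV)) hPV)⟩
  have hA : A = univ := by
    refine IsClopen.eq_univ ⟨hAc, hAo⟩ ⟨y₀, ?_⟩
    obtain ⟨U, hU, h⟩ := hstep y₀
    exact ⟨U, hU, h y₀ (mem_of_mem_nhds hU) h₀⟩
  obtain ⟨K, C, hK, hC, h⟩ : P univ := by
    refine isCompact_univ.induction_on (hmono _ _ (empty_subset _) h₀) hmono ?_ ?_
    · rintro s t ⟨K, C, hK, hC, h⟩ ⟨K', C', hK', hC', h'⟩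
      refine ⟨K ∪ K', C + C', hK.union hK', by positivity, fun u ε hu hε hw y hy ↦ ?_⟩
      have e1 : 0 ≤ C * ε := by positivity
      have e2 : 0 ≤ C' * ε := by positivity
      rcases hy with hy | hy
      · linarith [h u ε hu hε (fun w hwK ↦ hw w (.inl hwK)) y hy]
      · linarith [h' u ε hu hε (fun w hwK ↦ hw w (.inr hwK)) y hy]
    · intro y _
      obtain ⟨U, hU, hP⟩ : y ∈ A := hA ▸ mem_univ y
      exact ⟨U, mem_nhdsWithin_of_mem_nhds hU, hP⟩
  exact ⟨K, C, hK, hC, fun u ε hu hε hw y ↦ h u ε hu hε hw y (mem_univ y)⟩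

end Oscillation

/-! ### Extension of functions from embedded submanifolds, and reparametrization. -/

section Embedding

variable {m k : ℕ} {N : Type*} [TopologicalSpace N] [ChartedSpace (EuclideanSpace ℝ (Fin m)) N]
  {M : Type*} [TopologicalSpace M]
  [ChartedSpace (EuclideanSpace ℝ (Fin k)) M]

/-- A smooth embedding has smooth local left inverses. -/
theorem IsSmoothEmbedding.exists_local_leftInverse {i : N → M}
    (hi : IsSmoothEmbedding (𝓡 m) (𝓡 k) ∞ i) (y : N) :
    ∃ V ∈ 𝓝 (i y), ∃ r : M → N, ContMDiffOn (𝓡 k) (𝓡 m) ∞ r V ∧ ∀ y', i y' ∈ V → r (i y') = y' := by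
  -- In suitable charts an immersion is `x ↦ (x, 0)`, so projecting to the first factor (`q`)
  -- inverts it.
  have h : IsImmersionAt (𝓡 m) (𝓡 k) ∞ i y := hi.isImmersion.isImmersionAt y
  let q : M → EuclideanSpace ℝ (Fin m) := fun x ↦ (h.equiv.symm (h.codChart.extend (𝓡 k) x)).1
  have hq : ∀ y' ∈ h.domChart.source, q (i y') = h.domChart.extend (𝓡 m) y' := by
    intro y' hy'
    have hmem : h.domChart.extend (𝓡 m) y' ∈ (h.domChart.extend (𝓡 m)).target :=
      (h.domChart.extend (𝓡 m)).map_source (by rwa [h.domChart.extend_source])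
    have heq := h.writtenInCharts hmem
    rw [Function.comp_apply, Function.comp_apply, h.domChart.extend_left_inv hy',
      Function.comp_apply] at heq
    simp only [q]
    rw [heq, ContinuousLinearEquiv.symm_apply_apply]
  have hqs : ContMDiffOn (𝓡 k) 𝓘(ℝ, EuclideanSpace ℝ (Fin m)) ∞ q h.codChart.source := by
    have h1 : ContDiff ℝ ∞ (fun z ↦ (h.equiv.symm z).1) :=
      contDiff_fst.comp h.equiv.symm.contDiff
    exact h1.contMDiff.comp_contMDiffOn (h.codChart.contMDiffOn_extend h.codChart_mem_maximalAtlas)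
  -- `V₀` excludes points of `N` outside the domain chart whose images return near `i y`; this is
  -- where embedding is needed beyond immersion.
  obtain ⟨V₀, hV₀, hV₀s⟩ := hi.isEmbedding.isInducing.isOpen_iff.1 h.domChart.open_source
  have htgt : IsOpen (h.domChart.extend (𝓡 m)).target := by
    simpa [OpenPartialHomeomorph.extend_target] using h.domChart.open_target
  have hiy : i y ∈ V₀ := by
    have := h.mem_domChart_source
    rw [← hV₀s] at this
    exact this
  refine ⟨(h.codChart.source ∩ q ⁻¹' (h.domChart.extend (𝓡 m)).target) ∩ V₀,
    inter_mem ((hqs.continuousOn.isOpen_inter_preimage h.codChart.open_source htgt).mem_nhds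
      ⟨h.mem_codChart_source, ?_⟩) (hV₀.mem_nhds hiy),
    (h.domChart.extend (𝓡 m)).symm ∘ q, ?_, ?_⟩
  · rw [mem_preimage, hq y h.mem_domChart_source]
    exact (h.domChart.extend (𝓡 m)).map_source (by simpa using h.mem_domChart_source)
  · exact (contMDiffOn_extend_symm h.domChart_mem_maximalAtlas).comp
      (hqs.mono fun x hx ↦ hx.1.1) fun x hx ↦ by
        have := hx.1.2
        rw [mem_preimage, h.domChart.extend_target_eq_image_source] at this
        obtain ⟨z, hz, hzq⟩ := this
        exact ⟨h.domChart z, h.domChart.map_source hz, hzq⟩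
  · rintro y' ⟨-, hy'⟩
    have hy'' : y' ∈ h.domChart.source := by rw [← hV₀s]; exact hy'
    simp [hq y' hy'', hy'']

/-- Smooth functions extend from embedded compact submanifolds. -/
theorem IsSmoothEmbedding.exists_extension [IsManifold (𝓡 k) ∞ M] [T2Space M] [SigmaCompactSpace M]
    [CompactSpace N]
    {i : N → M} (hi : IsSmoothEmbedding (𝓡 m) (𝓡 k) ∞ i) {θ : N → ℝ}
    (hθ : ContMDiff (𝓡 m) 𝓘(ℝ, ℝ) ∞ θ) : ∃ F : C^∞⟮𝓡 k, M; ℝ⟯, ∀ y, F (i y) = θ y := by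
  have hcl : IsClosed (range i) := (isCompact_range hi.isEmbedding.continuous).isClosed
  -- The constraint prescribes the value on the image and is empty elsewhere; it is convex, so a
  -- partition of unity glues the local extensions `θ ∘ r` and `0`.
  let t : M → Set ℝ := fun x ↦ {r | ∀ y, i y = x → r = θ y}
  have ht : ∀ x, Convex ℝ (t x) := by
    intro x a ha b hb s t _ _ hst y hy
    simp only [ha y hy, hb y hy, smul_eq_mul]
    rw [← add_mul, hst, one_mul]
  have hloc : ∀ x, ∃ U ∈ 𝓝 x, ∃ g : M → ℝ, ContMDiffOn (𝓡 k) 𝓘(ℝ, ℝ) ∞ g U ∧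
      ∀ y ∈ U, g y ∈ t y := by
    intro x
    by_cases hx : x ∈ range i
    · obtain ⟨y, rfl⟩ := hx
      obtain ⟨V, hV, r, hr, hri⟩ := IsSmoothEmbedding.exists_local_leftInverse hi y
      refine ⟨V, hV, θ ∘ r, hθ.comp_contMDiffOn hr, ?_⟩
      rintro _ hx y' rfl
      simp [hri y' hx]
    · exact ⟨(range i)ᶜ, hcl.isOpen_compl.mem_nhds hx, fun _ ↦ 0, contMDiffOn_const,
        fun x' hx' y' hy' ↦ absurd ⟨y', hy'⟩ hx'⟩
  obtain ⟨F, hF⟩ := exists_contMDiffMap_forall_mem_convex_of_local (𝓡 k) ht hloc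
  exact ⟨F, fun y ↦ hF (i y) y rfl⟩

/-- Two smooth embeddings of a compact manifold with the same image differ by a smooth map. -/
theorem IsSmoothEmbedding.exists_eq_comp {i j : N → M}
    (hi : IsSmoothEmbedding (𝓡 m) (𝓡 k) ∞ i) (hj : IsSmoothEmbedding (𝓡 m) (𝓡 k) ∞ j)
    (hij : range i ⊆ range j) : ∃ φ : N → N, ContMDiff (𝓡 m) (𝓡 m) ∞ φ ∧ ∀ y, j (φ y) = i y := by
  choose φ hφ using fun y ↦ hij ⟨y, rfl⟩
  have hφ' : j ∘ φ = i := funext hφ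
  -- Smoothness descends through the immersion `j` once `φ` is continuous, which holds because `j`
  -- is a topological embedding.
  refine ⟨φ, (ContMDiff.iff_comp_isImmersion hj.isImmersion).2 ⟨?_, ?_⟩, hφ⟩
  · rw [hj.isEmbedding.continuous_iff, hφ']
    exact hi.isEmbedding.continuous
  · rw [hφ']
    exact hi.contMDiff

end Embedding

/-! ### The logarithmic covariant derivative and the phase of a section along a map. -/

section

/-- The derivative of the phase `z ↦ z / |z|` kills the radial directions. -/
theorem exists_hasFDerivAt_phase {x : ℂ} (hx : x ≠ 0) :
    ∃ u' : ℂ →L[ℝ] ℂ, HasFDerivAt (fun z : ℂ ↦ ((‖z‖⁻¹ : ℝ) : ℂ) * z) u' x ∧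
      ∀ b : ℂ, ‖u' (b * x)‖ = |b.im| := by
  have hg : HasFDerivAt (fun z : ℂ ↦ z) (ContinuousLinearMap.id ℝ ℂ) x := hasFDerivAt_id x
  have hn0 : ‖x‖ ≠ 0 := norm_ne_zero_iff.2 hx
  obtain ⟨n', hn'⟩ : ∃ n' : ℂ →L[ℝ] ℝ, HasFDerivAt (fun z : ℂ ↦ ‖z‖) n' x :=
    ⟨_, (hg.differentiableAt.norm ℝ hx).hasFDerivAt⟩
  have hsq : HasFDerivAt (fun z : ℂ ↦ ‖z‖ ^ 2) _ x := hn'.pow 2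
  have hsq' := hg.norm_sq
  have hinv := (hasDerivAt_inv hn0).comp_hasFDerivAt x hn'
  have hof := Complex.ofRealCLM.hasFDerivAt.comp x hinv
  refine ⟨_, hof.mul hg, fun b ↦ ?_⟩
  -- Differentiating `‖z‖²` in two ways determines the derivative of the norm. The derivative of the
  -- phase at `x` along `b x` is then `(x/‖x‖) · i Im b`.
  have h1 : ‖x‖ * n' (b * x) = ‖x‖ ^ 2 * b.re := by
    have := congrArg (fun l : ℂ →L[ℝ] ℝ ↦ l (b * x)) (hsq.unique hsq')
    simp [Complex.inner] at this
    have h2 : ‖x‖ ^ 2 = x.re ^ 2 + x.im ^ 2 := by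
      rw [← Complex.normSq_eq_norm_sq, Complex.normSq_apply]; ring
    rw [h2]
    nlinarith
  have h2 : n' (b * x) = ‖x‖ * b.re := by
    have : ‖x‖ * (n' (b * x) - ‖x‖ * b.re) = 0 := by linear_combination h1
    rcases mul_eq_zero.1 this with h | h
    · exact absurd h hn0
    · linarith
  have h3 : ∀ w : ℂ, w = ((‖x‖⁻¹ : ℝ) : ℂ) * x * (Complex.I * b.im) → ‖w‖ = |b.im| := by
    rintro _ rfl
    simp [hn0]
  apply h3
  have hc : (‖x‖ : ℂ) ≠ 0 := by exact_mod_cast hn0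
  simp [h2]
  field_simp
  linear_combination (-1 : ℂ) * Complex.re_add_im b

variable {n : ℕ} {M : Type*} [TopologicalSpace M]
  [ChartedSpace (EuclideanSpace ℝ (Fin (2 * n))) M]
  {L : M → Type*} [TopologicalSpace (TotalSpace ℂ L)]
  [∀ x, NormedAddCommGroup (L x)] [∀ x, InnerProductSpace ℂ (L x)]
  [FiberBundle ℂ L] [VectorBundle ℂ ℂ L]

/-- Each fibre is a complex line, by the trivialization, so the orthogonal projection onto `s` is
the identity. -/
theorem eq_inner_div_inner_smul {x : M} {s : L x} (hs : s ≠ 0) (t : L x) :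
    t = (inner ℂ s t / inner ℂ s s) • s := by
  have h1 : Module.finrank ℂ (L x) = 1 := by
    rw [((trivializationAt ℂ L x).continuousLinearEquivAt ℂ x
      (mem_baseSet_trivializationAt ℂ L x)).toLinearEquiv.finrank_eq]
    exact Module.finrank_self ℂ
  obtain ⟨c, rfl⟩ := (finrank_eq_one_iff_of_nonzero' s hs).1 h1 t
  have : inner ℂ s s ≠ 0 := inner_self_ne_zero.2 hs
  rw [inner_smul_right, mul_div_assoc, div_self this, mul_one]

/-- The logarithmic covariant derivative of a section: `∇ α = logCov a α • α` where `α ≠ 0`. -/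
def logCov (a : CovariantDerivative (𝓡 (2 * n)) ℂ L) (α : Π x, L x)
    (w : TangentBundle (𝓡 (2 * n)) M) : ℂ :=
  inner ℂ (α w.proj) (a α w.proj w.2) / inner ℂ (α w.proj) (α w.proj)

theorem eq_logCov_smul (a : CovariantDerivative (𝓡 (2 * n)) ℂ L) {α : Π x, L x}
    {w : TangentBundle (𝓡 (2 * n)) M} (hw : α w.proj ≠ 0) :
    a α w.proj w.2 = logCov a α w • α w.proj :=
  eq_inner_div_inner_smul hw _

variable [IsManifold (𝓡 (2 * n)) ∞ M] [VectorBundle ℝ ℂ L]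
  [ContMDiffVectorBundle ∞ ℂ L (𝓡 (2 * n))]

theorem isOpen_ne_zero (hL : IsSmoothHermitian n L) {α : Π x, L x} (hα : α ∈ Sections n L) :
    IsOpen {x | α x ≠ 0} := by
  have h : Continuous (fun x ↦ inner ℂ (α x) (α x)) := (hL α hα α hα).continuous
  convert h.isOpen_preimage _ (isOpen_compl_singleton (x := (0 : ℂ))) using 1
  ext x
  simp

/-- In a trivialization `logCov` is the quotient of the coordinates of `∇α` and `α`. Smoothness of
the metric is stated for sections over `M`, whereas `w ↦ ∇_w α` lives over `TM`, hence coordinates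
instead of inner products. -/
theorem continuousAt_logCov {a : CovariantDerivative (𝓡 (2 * n)) ℂ L} {Ω : SymplecticForm n M}
    (hL : IsSmoothHermitian n L) (ha : IsPrequantum Ω a) {α : Π x, L x} (hα : α ∈ Sections n L)
    {w₀ : TangentBundle (𝓡 (2 * n)) M} (hw₀ : α w₀.proj ≠ 0) :
    ContinuousAt (logCov a α) w₀ := by
  have hπ : Continuous (TotalSpace.proj : TangentBundle (𝓡 (2 * n)) M → M) :=
    FiberBundle.continuous_proj _ _
  have h1 := ha.smooth.contMDiff.contMDiff (σ := α) (contMDiffOn_univ.2 (by simpa using! hα))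
  rw [contMDiffOn_univ] at h1
  have h2 : ContMDiff (𝓡 (2 * n)).tangent ((𝓡 (2 * n)).prod 𝓘(ℝ, ℂ)) ∞
      (fun w : TangentBundle (𝓡 (2 * n)) M ↦ TotalSpace.mk' ℂ w.proj (a α w.proj w.2)) :=
    ContMDiff.clm_bundle_apply (h1.comp (contMDiff_proj _)) contMDiff_id
  set e := trivializationAt ℂ L w₀.proj
  have hmem : w₀.proj ∈ e.baseSet := mem_baseSet_trivializationAt ℂ L w₀.proj
  have hc : ∀ q : TangentBundle (𝓡 (2 * n)) M → TotalSpace ℂ L, Continuous q →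
      (q w₀).proj = w₀.proj → ContinuousAt (fun w ↦ (e (q w)).2) w₀ := by
    intro q hq hqw
    refine continuousAt_snd.comp
      (ContinuousAt.comp (e.continuousOn.continuousAt ?_) hq.continuousAt)
    exact e.open_source.mem_nhds (by rw [e.mem_source, hqw]; exact hmem)
  have hα' : Continuous (fun x ↦ TotalSpace.mk' ℂ x (α x)) := ContMDiff.continuous hα
  have h3 := hc _ h2.continuous rfl
  have h4 := hc _ (hα'.comp hπ) rfl
  have hne : ∀ x ∈ e.baseSet, α x ≠ 0 → (e ⟨x, α x⟩).2 ≠ 0 := by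
    intro x hx h0 h
    refine h0 ((e.continuousLinearEquivAt ℂ x hx).injective ?_)
    rw [map_zero]
    exact h
  refine (h3.div h4 (hne _ hmem hw₀)).congr_of_eventuallyEq ?_
  filter_upwards [hπ.continuousAt.preimage_mem_nhds (e.open_baseSet.mem_nhds hmem),
    hπ.continuousAt.preimage_mem_nhds ((isOpen_ne_zero hL hα).mem_nhds hw₀)] with w hw hw'
  refine (eq_div_iff (hne _ hw hw')).2 ?_
  have := (e.linear ℂ hw).2 (logCov a α w) (α w.proj)
  rw [← smul_eq_mul]
  refine this.symm.trans ?_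
  rw [← eq_logCov_smul a hw']

/-- Serves as the open target in the compact-open topology on tangent maps, which makes the
smallness of `Im λ` a `C^1`-open condition on embeddings. -/
theorem isOpen_setOf_abs_im_logCov_lt {a : CovariantDerivative (𝓡 (2 * n)) ℂ L}
    {Ω : SymplecticForm n M} (hL : IsSmoothHermitian n L) (ha : IsPrequantum Ω a) {α : Π x, L x}
    (hα : α ∈ Sections n L) (ε : ℝ) :
    IsOpen {w | α w.proj ≠ 0 ∧ |(logCov a α w).im| < ε} := by
  have hπ : Continuous (TotalSpace.proj : TangentBundle (𝓡 (2 * n)) M → M) :=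
    FiberBundle.continuous_proj _ _
  rw [isOpen_iff_mem_nhds]
  rintro w ⟨hw, hε⟩
  have h := (Complex.continuous_im.abs.continuousAt.comp (continuousAt_logCov hL ha hα hw))
  exact inter_mem (hπ.continuousAt.preimage_mem_nhds ((isOpen_ne_zero hL hα).mem_nhds hw))
    (h.preimage_mem_nhds (Iio_mem_nhds hε))

section Lagrangian

variable {N : Type*} [TopologicalSpace N] [ChartedSpace (EuclideanSpace ℝ (Fin n)) N]

/-- The coefficient of a section along `i` with respect to a nonvanishing section. -/
def coeffAlong (i : N → M) (σ α : Π x, L x) (y : N) : ℂ :=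
  inner ℂ (σ (i y)) (α (i y)) / inner ℂ (σ (i y)) (σ (i y))

/-- `σ` need not be smooth on `M`; near each point of `N` it is replaced by a smooth section that
agrees with it along `i`. -/
theorem contMDiff_coeffAlong (hL : IsSmoothHermitian n L)
    {a : CovariantDerivative (𝓡 (2 * n)) ℂ L} {i : N → M}
    (hi : ContMDiff (𝓡 n) (𝓡 (2 * n)) ∞ i) {σ α : Π x, L x}
    (hσ : IsCovariantlyConstantAlong a i σ) (hσ0 : ∀ y, σ (i y) ≠ 0) (hα : α ∈ Sections n L) :
    ContMDiff (𝓡 n) 𝓘(ℝ, ℂ) ∞ (coeffAlong i σ α) := by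
  intro y
  obtain ⟨s, hs, hsσ, -⟩ := hσ y
  have h0 : inner ℂ (s (i y)) (s (i y)) ≠ 0 := by
    rw [hsσ.self_of_nhds]
    exact inner_self_ne_zero.2 (hσ0 y)
  have hdiv : ContDiffAt ℝ ∞ (fun z : ℂ × ℂ ↦ z.1 * z.2⁻¹)
      (inner ℂ (s (i y)) (α (i y)), inner ℂ (s (i y)) (s (i y))) :=
    contDiffAt_fst.mul (contDiffAt_snd.inv h0)
  have hpair := ((hL s hs α hα).comp hi y).prodMk_space ((hL s hs s hs).comp hi y)
  refine (ContDiffAt.comp_contMDiffAt (x := y)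
    (f := fun y ↦ (inner ℂ (s (i y)) (α (i y)), inner ℂ (s (i y)) (s (i y))))
    hdiv hpair).congr_of_eventuallyEq ?_
  filter_upwards [hsσ] with y' hy'
  simp [coeffAlong, hy', div_eq_mul_inv]

/-- Differentiate `⟨s, α⟩ = g ⟨s, s⟩` along `i`, with `s` a local smooth representative of `σ`.
Metric compatibility and `∇s = 0` along `i` kill the derivative of `⟨s, s⟩` and turn that of `⟨s,
α⟩` into `⟨s, ∇α⟩ = λ ⟨s, α⟩`. -/
theorem mvfderiv_coeffAlong {Ω : SymplecticForm n M} (hL : IsSmoothHermitian n L)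
    {a : CovariantDerivative (𝓡 (2 * n)) ℂ L} (ha : IsPrequantum Ω a) {i : N → M}
    (hi : ContMDiff (𝓡 n) (𝓡 (2 * n)) ∞ i) {σ α : Π x, L x}
    (hσ : IsCovariantlyConstantAlong a i σ) (hσ0 : ∀ y, σ (i y) ≠ 0) (hα : α ∈ Sections n L)
    (w : TangentBundle (𝓡 n) N) (hw : α (i w.proj) ≠ 0) :
    mvfderiv (𝓡 n) (coeffAlong i σ α) w.proj w.2 =
      logCov a α (tangentMap (𝓡 n) (𝓡 (2 * n)) i w) * coeffAlong i σ α w.proj := by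
  obtain ⟨y, v⟩ := w
  obtain ⟨s, hs, hsσ, hcov⟩ := hσ y
  have h0 : inner ℂ (s (i y)) (s (i y)) ≠ 0 := by
    rw [hsσ.self_of_nhds]
    exact inner_self_ne_zero.2 (hσ0 y)
  have hd : ∀ t ∈ Sections n L, MDifferentiableAt (𝓡 n) 𝓘(ℝ, ℂ)
      (fun y ↦ inner ℂ (s (i y)) (t (i y))) y ∧
      mvfderiv (𝓡 n) (fun y ↦ inner ℂ (s (i y)) (t (i y))) y v =
        inner ℂ (s (i y)) (a t (i y) (mfderiv (𝓡 n) (𝓡 (2 * n)) i y v)) := by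
    intro t ht
    refine ⟨((hL s hs t ht).comp hi y).mdifferentiableAt (by simp), ?_⟩
    have h1 := ha.hermitian s hs t ht (i y) (mfderiv (𝓡 n) (𝓡 (2 * n)) i y v)
    rw [hcov v, inner_zero_left, zero_add] at h1
    rw [← h1]
    have h2 := mfderiv_comp y ((hL s hs t ht).mdifferentiableAt (x := i y) (by simp))
      (hi.mdifferentiableAt (x := y) (by simp))
    exact congrArg (fun l ↦ l v) h2
  have hG := ((contMDiff_coeffAlong hL hi hσ hσ0 hα).mdifferentiableAt (x := y)
    (by simp)).hasMFDerivAt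
  obtain ⟨hP, hP'⟩ := hd α hα
  obtain ⟨hQ, hQ'⟩ := hd s hs
  rw [hcov v, inner_zero_right] at hQ'
  have hPG : (fun y ↦ inner ℂ (s (i y)) (α (i y))) =ᶠ[𝓝 y]
      (coeffAlong i σ α) * (fun y ↦ inner ℂ (s (i y)) (s (i y))) := by
    filter_upwards [hsσ] with y' hy'
    simp only [Pi.mul_apply, coeffAlong, hy']
    rw [div_mul_cancel₀ _ (inner_self_ne_zero.2 (hσ0 y'))]
  have hprod := ((hG.mul hQ.hasMFDerivAt).congr_of_eventuallyEq hPG).mfderiv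
  have hprod' := congrArg (fun l ↦ l v) hprod
  have e1 : mvfderiv (𝓡 n) (fun y ↦ inner ℂ (s (i y)) (α (i y))) y v =
      coeffAlong i σ α y * mvfderiv (𝓡 n) (fun y ↦ inner ℂ (s (i y)) (s (i y))) y v +
      inner ℂ (s (i y)) (s (i y)) * mvfderiv (𝓡 n) (coeffAlong i σ α) y v := hprod'
  rw [hP', hQ', mul_zero, zero_add] at e1
  have e2 : inner ℂ (s (i y)) (α (i y)) =
      coeffAlong i σ α y * inner ℂ (s (i y)) (s (i y)) := hPG.self_of_nhds
  have e4 : a α (i y) (mfderiv (𝓡 n) (𝓡 (2 * n)) i y v) =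
    logCov a α (tangentMap (𝓡 n) (𝓡 (2 * n)) i ⟨y, v⟩) • α (i y) :=
    eq_logCov_smul (w := tangentMap (𝓡 n) (𝓡 (2 * n)) i ⟨y, v⟩) a hw
  rw [e4, inner_smul_right, e2] at e1
  refine mul_left_cancel₀ h0 ?_
  rw [← e1]
  ring

end Lagrangian

end

section

variable {n : ℕ} {M : Type*} [TopologicalSpace M]
  [ChartedSpace (EuclideanSpace ℝ (Fin (2 * n))) M] [IsManifold (𝓡 (2 * n)) ∞ M]
  {L : M → Type*} [TopologicalSpace (TotalSpace ℂ L)]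
  [∀ x, NormedAddCommGroup (L x)] [∀ x, InnerProductSpace ℂ (L x)]
  [FiberBundle ℂ L] [VectorBundle ℂ ℂ L] [VectorBundle ℝ ℂ L]
  [ContMDiffVectorBundle ∞ ℂ L (𝓡 (2 * n))]
  {N : Type*} [TopologicalSpace N] [ChartedSpace (EuclideanSpace ℝ (Fin n)) N]
  {Ω : SymplecticForm n M} {a : CovariantDerivative (𝓡 (2 * n)) ℂ L}

/-! ### The action of phase changes on sections and their classes. -/

section Phase

theorem phaseMul_zero (α : Sections n L) : phaseMul (0 : C^∞⟮𝓡 (2 * n), M; ℝ⟯) α = α := by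
  refine Subtype.ext (funext fun x ↦ ?_)
  simp [phaseMul]

theorem phaseMul_phaseMul (F G : C^∞⟮𝓡 (2 * n), M; ℝ⟯) (α : Sections n L) :
    phaseMul F (phaseMul G α) = phaseMul (F + G) α := by
  refine Subtype.ext (funext fun x ↦ ?_)
  simp [phaseMul, smul_smul, ← Complex.exp_add, mul_add]

theorem phase_zero (p : ℙ ℂ (Sections n L)) : phase (0 : C^∞⟮𝓡 (2 * n), M; ℝ⟯) p = p := by
  induction p using Projectivization.ind with
  | h α hα => simp [phase, Projectivization.map_mk, phaseMul_zero]

/-- Lets any point of a phase orbit serve as the base point, which upgrades the local lifting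
statement to openness. -/
theorem phase_phase (F G : C^∞⟮𝓡 (2 * n), M; ℝ⟯) (p : ℙ ℂ (Sections n L)) :
    phase F (phase G p) = phase (F + G) p := by
  induction p using Projectivization.ind with
  | h α hα => simp [phase, Projectivization.map_mk, phaseMul_phaseMul]

theorem phase_mem_vanishingOn (F : C^∞⟮𝓡 (2 * n), M; ℝ⟯) {p : ℙ ℂ (Sections n L)} {D : Set M}
    (hp : p ∈ vanishingOn D) : phase F p ∈ vanishingOn D := by
  obtain ⟨α, hα, rfl, rfl⟩ := hp
  refine ⟨phaseMul F α, fun h ↦ hα (phaseMul_injective F (by rw [h, map_zero])),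
    Projectivization.map_mk _ _ _ _, ?_⟩
  ext x
  simp [phaseMul, Complex.exp_ne_zero]

end Phase

/-! ### Lifting nearby Bohr–Sommerfeld lagrangians to the universal object. -/

/-- The covariantly constant phase of a section does not depend on the parametrization. -/
theorem exists_eq_smul_of_image_eq {i j : BSEmbedding N Ω a} [CompactSpace N]
    (hij : i.image = j.image) {α σ : Π x, L x} {c : ℝ} {f : N → ℝ}
    (hσ : IsCovariantlyConstantAlong a j.toFun σ) (hσ0 : ∀ y, σ (j.toFun y) ≠ 0)
    (hf : ContMDiff (𝓡 n) 𝓘(ℝ, ℝ) ∞ f) (hf0 : ∀ y, 0 < f y)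
    (hα : ∀ y, α (j.toFun y) = (Complex.exp (Complex.I * (c : ℂ)) * (f y : ℂ)) • σ (j.toFun y)) :
    ∃ f' : N → ℝ, IsCovariantlyConstantAlong a i.toFun σ ∧ (∀ y, σ (i.toFun y) ≠ 0) ∧
      ContMDiff (𝓡 n) 𝓘(ℝ, ℝ) ∞ f' ∧ (∀ y, 0 < f' y) ∧
      ∀ y, α (i.toFun y) = (Complex.exp (Complex.I * (c : ℂ)) * (f' y : ℂ)) • σ (i.toFun y) := by
  have hr : range i.toFun = range j.toFun := congrArg BSLagrangian.carrier hij
  -- The universal object supplies some parametrization `j` of the lagrangian, not the given `i`;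
  -- the data are pulled back by `φ` with `i = j ∘ φ`.
  obtain ⟨φ, hφ, hφj⟩ := IsSmoothEmbedding.exists_eq_comp i.isBohrSommerfeld.embedding
    j.isBohrSommerfeld.embedding hr.le
  have hcomp : i.toFun = j.toFun ∘ φ := funext fun y ↦ (hφj y).symm
  refine ⟨f ∘ φ, fun y ↦ ?_, fun y ↦ ?_, hf.comp hφ, fun y ↦ hf0 _, fun y ↦ ?_⟩
  · obtain ⟨s, hs, hsσ, hcov⟩ := hσ (φ y)
    refine ⟨s, hs, ?_, fun v ↦ ?_⟩
    · filter_upwards [hφ.continuous.continuousAt.eventually hsσ] with y' hy'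
      rw [hcomp]
      exact hy'
    · rw [hcomp, mfderiv_comp y (j.isBohrSommerfeld.embedding.contMDiff.mdifferentiableAt
        (by simp)) (hφ.mdifferentiableAt (by simp))]
      exact hcov _
  · rw [← hφj]
    exact hσ0 _
  · rw [← hφj]
    exact hα _

/-- The derivative of the phase of the coefficient of a section along a map. -/
theorem norm_mvfderiv_phase_coeffAlong (hL : IsSmoothHermitian n L) (ha : IsPrequantum Ω a)
    {i : N → M} (hi : ContMDiff (𝓡 n) (𝓡 (2 * n)) ∞ i) {σ α : Π x, L x}
    (hσ : IsCovariantlyConstantAlong a i σ) (hσ0 : ∀ y, σ (i y) ≠ 0) (hα : α ∈ Sections n L)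
    (hg0 : ∀ y, coeffAlong i σ α y ≠ 0) (w : TangentBundle (𝓡 n) N) (hw : α (i w.proj) ≠ 0) :
    ‖mvfderiv (𝓡 n) (fun y ↦ ((‖coeffAlong i σ α y‖⁻¹ : ℝ) : ℂ) * coeffAlong i σ α y) w.proj w.2‖ =
      |(logCov a α (tangentMap (𝓡 n) (𝓡 (2 * n)) i w)).im| := by
  obtain ⟨u', hu', hu⟩ := exists_hasFDerivAt_phase (hg0 w.proj)
  have hg := ((contMDiff_coeffAlong hL hi hσ hσ0 hα).mdifferentiableAt (x := w.proj)
    (by simp)).hasMFDerivAt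
  have h1 := congrArg (fun l ↦ l w.2) (hu'.hasMFDerivAt.comp w.proj hg).mfderiv
  have h2 : mvfderiv (𝓡 n) (fun y ↦ ((‖coeffAlong i σ α y‖⁻¹ : ℝ) : ℂ) * coeffAlong i σ α y)
      w.proj w.2 = u' (mvfderiv (𝓡 n) (coeffAlong i σ α) w.proj w.2) := h1
  -- Here `dg = λ g`, so `hu` applies with `b = λ` and only `|Im λ|` survives.
  rw [h2, mvfderiv_coeffAlong hL ha hi hσ hσ0 hα w hw, hu]

/-- A section which is, up to a constant phase, a positive multiple of a covariantly constant
section has real logarithmic covariant derivative. -/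
theorem im_logCov_tangentMap_eq_zero (hL : IsSmoothHermitian n L) (ha : IsPrequantum Ω a)
    {i : N → M} (hi : ContMDiff (𝓡 n) (𝓡 (2 * n)) ∞ i) {σ α : Π x, L x} {c : ℝ} {f : N → ℝ}
    (hσ : IsCovariantlyConstantAlong a i σ) (hσ0 : ∀ y, σ (i y) ≠ 0) (hα : α ∈ Sections n L)
    (hf0 : ∀ y, 0 < f y)
    (hαf : ∀ y, α (i y) = (Complex.exp (Complex.I * (c : ℂ)) * (f y : ℂ)) • σ (i y))
    (w : TangentBundle (𝓡 n) N) : (logCov a α (tangentMap (𝓡 n) (𝓡 (2 * n)) i w)).im = 0 := by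
  have hcoeff : ∀ y, coeffAlong i σ α y = Complex.exp (Complex.I * (c : ℂ)) * (f y : ℂ) := by
    intro y
    rw [coeffAlong, hαf, inner_smul_right, mul_div_assoc, div_self, mul_one]
    exact inner_self_ne_zero.2 (hσ0 y)
  have hf' : ∀ y, (f y : ℂ) ≠ 0 := fun y ↦ by exact_mod_cast (hf0 y).ne'
  have hne : ∀ y, Complex.exp (Complex.I * (c : ℂ)) * (f y : ℂ) ≠ 0 := fun y ↦
    mul_ne_zero (Complex.exp_ne_zero _) (hf' y)
  have h := norm_mvfderiv_phase_coeffAlong hL ha hi hσ hσ0 hα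
    (fun y ↦ by rw [hcoeff]; exact hne y) w (by rw [hαf]; exact smul_ne_zero (hne _) (hσ0 _))
  -- The phase of `e^{ic} f` with `f > 0` is the constant `e^{ic}`.
  have hconst : (fun y ↦ ((‖coeffAlong i σ α y‖⁻¹ : ℝ) : ℂ) * coeffAlong i σ α y) =
      fun _ ↦ Complex.exp (Complex.I * (c : ℂ)) := by
    funext y
    rw [hcoeff, norm_mul, mul_comm Complex.I, Complex.norm_exp_ofReal_mul_I, one_mul,
      Complex.norm_real, Real.norm_of_nonneg (hf0 y).le]
    push_cast
    field_simp [hf' y]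
  rw [hconst, mvfderiv_const] at h
  simpa using h.symm

/-- A function whose phase is nowhere opposite to a given one has a smooth argument. -/
theorem exists_contMDiff_arg {g : N → ℂ} (hg : ContMDiff (𝓡 n) 𝓘(ℝ, ℂ) ∞ g)
    (hg0 : ∀ y, g y ≠ 0) {ζ : ℂ} (hζ : ‖ζ‖ = 1)
    (h : ∀ y, ‖((‖g y‖⁻¹ : ℝ) : ℂ) * g y - ζ‖ < 1) :
    ∃ θ : N → ℝ, ContMDiff (𝓡 n) 𝓘(ℝ, ℝ) ∞ θ ∧
      ∀ y, g y = Complex.exp (Complex.I * θ y) * ‖g y‖ * ζ := by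
  have hζ0 : ζ ≠ 0 := norm_ne_zero_iff.1 (by rw [hζ]; exact one_ne_zero)
  -- Distance less than 1 from 1 forces positive real part, so the principal logarithm is smooth
  -- there and its imaginary part is `θ`.
  have hslit : ∀ y, g y / ζ ∈ Complex.slitPlane := by
    intro y
    left
    have hn : 0 < ‖g y‖ := norm_pos_iff.2 (hg0 y)
    have h1 : ‖((‖g y‖⁻¹ : ℝ) : ℂ) * (g y / ζ) - 1‖ < 1 := by
      have : ((‖g y‖⁻¹ : ℝ) : ℂ) * (g y / ζ) - 1 = (((‖g y‖⁻¹ : ℝ) : ℂ) * g y - ζ) / ζ := by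
        field_simp
      rw [this, norm_div, hζ, div_one]
      exact h y
    have h2 := (abs_lt.1 ((Complex.abs_re_le_norm _).trans_lt h1)).1
    rw [Complex.sub_re, Complex.re_ofReal_mul, Complex.one_re] at h2
    exact pos_of_mul_pos_right (by linarith : 0 < ‖g y‖⁻¹ * (g y / ζ).re) (by positivity)
  refine ⟨fun y ↦ (Complex.log (g y / ζ)).im, fun y ↦ ?_, fun y ↦ ?_⟩
  · have h1 : ContDiffAt ℝ ∞ (fun z ↦ (Complex.log (z / ζ)).im) (g y) :=
      Complex.imCLM.contDiff.contDiffAt.comp _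
        (((Complex.contDiffAt_log (hslit y)).restrict_scalars ℝ).comp (g y)
          (contDiffAt_id.div_const ζ))
    exact h1.comp_contMDiffAt (hg y)
  · have h1 := Complex.norm_mul_exp_arg_mul_I (g y / ζ)
    rw [norm_div, hζ, div_one] at h1
    simp only [Complex.log_im]
    rw [mul_comm Complex.I, mul_comm (Complex.exp _), h1, div_mul_cancel₀ _ hζ0]

variable [IsManifold (𝓡 n) ∞ N] [CompactSpace N] [ConnectedSpace N] [T2Space M] [CompactSpace M]

/-- Bohr-Sommerfeld embeddings close to one along which the section `α` is, up to a constant phase,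
a positive multiple of a covariantly constant section lift to the universal object after a phase
change of `α`. -/
theorem eventually_exists_phase_mem (hL : IsSmoothHermitian n L) (ha : IsPrequantum Ω a)
    (i₀ : BSEmbedding N Ω a) {α : Sections n L} (hα : α ≠ 0) {σ : Π x, L x} {c : ℝ} {f : N → ℝ}
    (hσ : IsCovariantlyConstantAlong a i₀.toFun σ) (hσ0 : ∀ y, σ (i₀.toFun y) ≠ 0)
    (hf0 : ∀ y, 0 < f y)
    (hαf : ∀ y, (α : Π x, L x) (i₀.toFun y) =
      (Complex.exp (Complex.I * (c : ℂ)) * (f y : ℂ)) • σ (i₀.toFun y)) :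
    ∀ᶠ i in 𝓝 i₀, ∃ F : C^∞⟮𝓡 (2 * n), M; ℝ⟯,
      (phase F (Projectivization.mk ℂ α hα), i.image) ∈ universalSBS N Ω a := by
  obtain ⟨y₀⟩ : Nonempty N := inferInstance
  obtain ⟨K, C, hK, hC, hosc⟩ := exists_isCompact_forall_norm_sub_le_mul (m := n) y₀
  -- The zero section is added to the compact set because its image under the tangent map covers
  -- `i(N)`: this forces `α ≠ 0` along nearby embeddings.
  let z : N → TangentBundle (𝓡 n) N := zeroSection (EuclideanSpace ℝ (Fin n)) (TangentSpace (𝓡 n))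
  have hz : IsCompact (range z) :=
    isCompact_range (contMDiff_zeroSection (IB := 𝓡 n) (n := 0) ℝ (TangentSpace (𝓡 n))).continuous
  -- Chosen so that `C * ε < 1`; `C + 1` avoids dividing by zero.
  set ε : ℝ := 1 / (2 * (C + 1))
  have hε : 0 < ε := by positivity
  have hCε : C * ε < 1 := by
    rw [mul_one_div, div_lt_one (by positivity)]
    linarith
  have hO := isOpen_setOf_abs_im_logCov_lt hL ha α.2 ε
  have h₀ : MapsTo i₀.tangent (K ∪ range z)
      {w | (α : Π x, L x) w.proj ≠ 0 ∧ |(logCov a α w).im| < ε} := by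
    intro w _
    constructor
    · change (α : Π x, L x) (i₀.toFun w.proj) ≠ 0
      rw [hαf]
      refine smul_ne_zero (mul_ne_zero (Complex.exp_ne_zero _) ?_) (hσ0 _)
      exact_mod_cast (hf0 _).ne'
    · change |(logCov a α (tangentMap (𝓡 n) (𝓡 (2 * n)) i₀.toFun w)).im| < ε
      rw [im_logCov_tangentMap_eq_zero hL ha i₀.isBohrSommerfeld.embedding.contMDiff hσ hσ0 α.2
        hf0 hαf, abs_zero]
      exact hε
  have hnear : ∀ᶠ i in 𝓝 i₀, MapsTo (BSEmbedding.tangent i) (K ∪ range z)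
      {w | (α : Π x, L x) w.proj ≠ 0 ∧ |(logCov a α w).im| < ε} :=
    continuous_induced_dom.continuousAt.eventually
      (ContinuousMap.eventually_mapsTo (hK.union hz) hO h₀)
  filter_upwards [hnear] with i hi
  have hism := i.isBohrSommerfeld.embedding.contMDiff
  obtain ⟨τ, hτ, hτ0⟩ := i.isBohrSommerfeld.exists_section
  have hα0 : ∀ y, (α : Π x, L x) (i.toFun y) ≠ 0 := fun y ↦ (hi (.inr ⟨y, rfl⟩)).1
  set g := coeffAlong i.toFun τ α
  have hg : ContMDiff (𝓡 n) 𝓘(ℝ, ℂ) ∞ g := contMDiff_coeffAlong hL hism hτ hτ0 α.2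
  have hαg : ∀ y, (α : Π x, L x) (i.toFun y) = g y • τ (i.toFun y) := fun y ↦
    eq_inner_div_inner_smul (hτ0 y) _
  have hg0 : ∀ y, g y ≠ 0 := fun y h ↦ hα0 y (by rw [hαg, h, zero_smul])
  have hphase : ContMDiff (𝓡 n) 𝓘(ℝ, ℂ) ∞ (fun y ↦ ((‖g y‖⁻¹ : ℝ) : ℂ) * g y) := by
    intro y
    have h1 : ContDiffAt ℝ ∞ (fun z : ℂ ↦ ((‖z‖⁻¹ : ℝ) : ℂ) * z) (g y) :=
      (Complex.ofRealCLM.contDiff.contDiffAt.comp _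
        ((contDiffAt_id.norm ℝ (hg0 y)).inv (norm_ne_zero_iff.2 (hg0 y)))).mul contDiffAt_id
    exact h1.comp_contMDiffAt (hg y)
  have hsmall := hosc _ ε (hphase.mdifferentiable (by simp)) hε.le fun w hw ↦ by
    rw [norm_mvfderiv_phase_coeffAlong hL ha hism hτ hτ0 α.2 hg0 w (hα0 _)]
    exact (hi (.inl hw)).2.le
  set ζ := ((‖g y₀‖⁻¹ : ℝ) : ℂ) * g y₀
  have hζ : ‖ζ‖ = 1 := by
    simp [ζ, hg0 y₀]
  obtain ⟨θ, hθ, hgθ⟩ := exists_contMDiff_arg hg hg0 hζ fun y ↦ (hsmall y).trans_lt hCε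
  -- Extending `-θ` cancels the varying phase, leaving the constant `ζ = e^{i arg ζ}` and the
  -- positive factor `‖g‖`.
  obtain ⟨F, hF⟩ := IsSmoothEmbedding.exists_extension i.isBohrSommerfeld.embedding hθ.neg
  refine ⟨F, phaseMul F α, fun h ↦ hα (phaseMul_injective F (by rw [h, map_zero])), i, τ,
    Complex.arg ζ, fun y ↦ ‖g y‖, ?_, hτ, hτ0, fun y ↦ ?_, fun y ↦ norm_pos_iff.2 (hg0 y),
    fun y ↦ ?_⟩
  · rw [phase, Projectivization.map_mk]
  · exact ContDiffAt.comp_contMDiffAt (f := g) (contDiffAt_id.norm ℝ (hg0 y)) (hg y)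
  · have h1 : Complex.exp (Complex.I * (Complex.arg ζ : ℂ)) = ζ := by
      have := Complex.norm_mul_exp_arg_mul_I ζ
      rwa [hζ, Complex.ofReal_one, one_mul, mul_comm] at this
    change Complex.exp (Complex.I * (F (i.toFun y) : ℂ)) • (α : Π x, L x) (i.toFun y) = _
    rw [hαg, smul_smul, h1, hF]
    congr 1
    have h2 : Complex.exp (Complex.I * ((-θ y : ℝ) : ℂ)) * Complex.exp (Complex.I * θ y) = 1 := by
      rw [← Complex.exp_add]
      simp
    calc _ = Complex.exp (Complex.I * ((-θ y : ℝ) : ℂ)) *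
          (Complex.exp (Complex.I * θ y) * ‖g y‖ * ζ) := by rw [← hgθ]
      _ = (Complex.exp (Complex.I * ((-θ y : ℝ) : ℂ)) * Complex.exp (Complex.I * θ y)) *
          (‖g y‖ * ζ) := by ring
      _ = _ := by rw [h2, one_mul, mul_comm]

/-- The Bohr-Sommerfeld lagrangians over which the universal object contains a point of the orbit of
`p` under phase changes form an open set. -/
theorem isOpen_setOf_exists_phase_mem (hL : IsSmoothHermitian n L) (ha : IsPrequantum Ω a)
    (p : ℙ ℂ (Sections n L)) :
    IsOpen {S : BSLagrangian N Ω a | ∃ F : C^∞⟮𝓡 (2 * n), M; ℝ⟯,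
      (phase F p, S) ∈ universalSBS N Ω a} := by
  -- In the quotient topology openness is tested on embeddings, so lifting is needed near every
  -- embedding whose image lies in the set, not only near one parametrization of `S`.
  rw [isOpen_coinduced, isOpen_iff_mem_nhds]
  rintro i ⟨G, α, hα, j, σ, c, f, heq, hσ, hσ0, hf, hf0, hαf⟩
  obtain ⟨hp, hij⟩ := Prod.mk.inj heq
  obtain ⟨f', hσ', hσ0', -, hf0', hαf'⟩ := exists_eq_smul_of_image_eq hij hσ hσ0 hf hf0 hαf
  filter_upwards [eventually_exists_phase_mem hL ha i hα hσ' hσ0' hf0' hαf'] with k ⟨F, hF⟩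
  rw [← hp, phase_phase] at hF
  exact ⟨F + G, hF⟩

end

end SBS

end

/-- Every Bohr-Sommerfeld lagrangian submanifold `S'` close enough to `S` lifts to a pair
`(P(F) [α], S')` in the universal object, within the same `ℙ(D)`. -/
theorem proposition5 {n : ℕ} {M : Type*} [TopologicalSpace M] [T2Space M] [CompactSpace M]
    [SimplyConnectedSpace M] [ChartedSpace (EuclideanSpace ℝ (Fin (2 * n))) M]
    [IsManifold (𝓡 (2 * n)) ∞ M] (Ω : SBS.SymplecticForm n M)
    {L : M → Type*} [TopologicalSpace (TotalSpace ℂ L)]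
    [∀ x, NormedAddCommGroup (L x)] [∀ x, InnerProductSpace ℂ (L x)]
    [FiberBundle ℂ L] [VectorBundle ℂ ℂ L] [VectorBundle ℝ ℂ L]
    [ContMDiffVectorBundle ∞ ℂ L (𝓡 (2 * n))]
    (hL : SBS.IsSmoothHermitian n L)
    (a : CovariantDerivative (𝓡 (2 * n)) ℂ L) (ha : SBS.IsPrequantum Ω a)
    {N : Type*} [TopologicalSpace N] [T2Space N] [CompactSpace N] [ConnectedSpace N]
    [ChartedSpace (EuclideanSpace ℝ (Fin n)) N] [IsManifold (𝓡 n) ∞ N]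
    (p : ℙ ℂ (SBS.Sections n L)) (S : SBS.BSLagrangian N Ω a)
    (h : (p, S) ∈ SBS.universalSBS N Ω a) :
    ∀ᶠ S' in 𝓝 S, ∃ F : C^∞⟮𝓡 (2 * n), M; ℝ⟯,
      (SBS.phase F p, S') ∈ SBS.universalSBS N Ω a ∧
      ∀ D : Set M, p ∈ SBS.vanishingOn D → SBS.phase F p ∈ SBS.vanishingOn D := by
  filter_upwards [(SBS.isOpen_setOf_exists_phase_mem hL ha p).mem_nhds
    ⟨0, by rwa [SBS.phase_zero]⟩] with S' ⟨F, hF⟩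
  exact ⟨F, hF, fun D hD ↦ SBS.phase_mem_vanishingOn F hD⟩
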